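/- Let $1\le k\le n$ and let $H$ be a map from a neighbourhood of $0\in\mathbb R$ to the Hermitian $n\times n$ complex matrices that is real analytic at $0$. Write $\lambda_1(t)\le\dots\le\lambda_n(t)$ for the eigenvalues of $H(t)$ in increasing order, with multiplicity, and assume $\lambda_1(0)=\dots=\lambda_k(0)$ and, if $k<n$, $\lambda_k(0)<\lambda_{k+1}(0)$. Let $$\overline\lambda(t)=\frac1k\sum_{j=1}^k\lambda_j(t),\qquad D_k(t)=\sqrt{\frac1k\sum_{j=1}^k\bigl(\lambda_j(t)-\overline\lambda(t)\bigr)^2}.$$ For a function $f$ analytic at $0$ let $\mathrm{ord}_0(f)\in\{0,1,2,\dots\}\cup\{\infty\}$ be its order of vanishing at $t=0$ (with $\mathrm{ord}_0(f)=\infty$ if $f$ vanishes identically near $0$); a minimum over an empty index set (which occurs only for $k=1$) is $\infty$. Then there is a permutation $i\mapsto i'$ of $\{1,\dots,n\}$ such that all the functions $$\widetilde\lambda_i(t)=\begin{cases}\lambda_i(t),& t\ge 0,\\ \lambda_{i'}(t),& t<0,\end{cases}\qquad 1\le i\le n,$$ are analytic at $0$. Moreover, there is an $r\in\{0,1,2,\dots\}\cup\{\infty\}$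 such that the signed standard deviation $$\mathfrak s_k(t)=(\mathrm{sgn}\,t)^r\,D_k(t)$$ (for $r=\infty$ the sign factor is omitted) is analytic at $0$ and such that, for every permutation as above, the functions $\mathfrak s_{i,j}=\widetilde\lambda_i-\widetilde\lambda_j$ and $\overline{\mathfrak s}_i=\widetilde\lambda_i-\overline\lambda$ ($1\le i,j\le k$) are analytic at $0$ and $$r=\mathrm{ord}_0(\mathfrak s_k)=\min_{1\le i<j\le k}\mathrm{ord}_0(\mathfrak s_{i,j})=\min_{1\le i\le k-1}\mathrm{ord}_0(\mathfrak s_{i,i+1})=\mathrm{ord}_0(\mathfrak s_{1,k})=\min_{1\le i\le k}\mathrm{ord}_0(\overline{\mathfrak s}_i).$$ -/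

import Mathlib

noncomputable section

namespace EnergySplitting

/-- Hermitian `n × n` complex matrices. -/
abbrev Herm (n : ℕ) : Type := {A : Matrix (Fin n) (Fin n) ℂ // A.IsHermitian}

/-- The eigenvalues `λ₁ ≤ ⋯ ≤ λₙ` of a Hermitian matrix, with multiplicity, in increasing order
(`eig A i` is `λ_{i+1}`). Mathlib's `eigenvalues₀` lists them in decreasing order. -/
def eig {n : ℕ} (A : Herm n) (i : Fin n) : ℝ :=
  A.2.eigenvalues₀ (Fin.cast (Fintype.card_fin n).symm i.rev)

theorem eig_monotone {n : ℕ} (A : Herm n) : Monotone (eig A) := by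
  intro i j hij
  refine A.2.eigenvalues₀_antitone ?_
  have h : (i : ℕ) ≤ j := hij
  simp only [Fin.le_def, Fin.val_cast, Fin.val_rev]
  omega

/-- `Σ_k`: the matrices with `λ₁ = ⋯ = λ_k < λ_{k+1}` (the last inequality is void for `k = n`). -/
def GroundDegenerate (n k : ℕ) : Set (Herm n) :=
  {A | (∀ i j : Fin n, (i : ℕ) < k → (j : ℕ) < k → eig A i = eig A j) ∧
    ∀ i j : Fin n, (i : ℕ) + 1 = k → (j : ℕ) = k → eig A i < eig A j}

/-- The mean of the lowest `k` eigenvalues. -/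
def lowMean {n k : ℕ} (hkn : k ≤ n) (A : Herm n) : ℝ :=
  (∑ i : Fin k, eig A (Fin.castLE hkn i)) / k

/-- The standard deviation `D_k` of the lowest `k` eigenvalues. -/
def lowStdDev {n k : ℕ} (hkn : k ≤ n) (A : Herm n) : ℝ :=
  Real.sqrt ((∑ i : Fin k, (eig A (Fin.castLE hkn i) - lowMean hkn A) ^ 2) / k)

section Family

attribute [local instance] Matrix.frobeniusNormedAddCommGroup Matrix.frobeniusNormedSpace

/-- `H` is real analytic at `0`, as a map into the matrices with the Frobenius norm. -/
def AnalyticAtZero {n : ℕ} (H : ℝ → Herm n) : Prop :=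
  AnalyticAt ℝ (fun t => (H t : Matrix (Fin n) (Fin n) ℂ)) 0

end Family

/-- The eigenvalue functions, re-indexed by the permutation `σ` for negative `t`. -/
def reorderedEig {n : ℕ} (H : ℝ → Herm n) (σ : Equiv.Perm (Fin n)) (i : Fin n) (t : ℝ) : ℝ :=
  if 0 ≤ t then eig (H t) i else eig (H t) (σ i)

/-- `σ` is a re-indexing for negative `t` that makes all eigenvalue functions analytic at `0`. -/
def IsAnalyticReordering {n : ℕ} (H : ℝ → Herm n) (σ : Equiv.Perm (Fin n)) : Prop :=
  ∀ i : Fin n, AnalyticAt ℝ (reorderedEig H σ i) 0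

/-- The pairwise splitting of the `i`-th and `j`-th eigenvalue, for `i, j` among the lowest `k`. -/
def pairSplitting {n k : ℕ} (hkn : k ≤ n) (H : ℝ → Herm n) (σ : Equiv.Perm (Fin n))
    (i j : Fin k) (t : ℝ) : ℝ :=
  reorderedEig H σ (Fin.castLE hkn i) t - reorderedEig H σ (Fin.castLE hkn j) t

/-- The splitting of the `i`-th eigenvalue from the mean of the lowest `k` eigenvalues. -/
def meanSplitting {n k : ℕ} (hkn : k ≤ n) (H : ℝ → Herm n) (σ : Equiv.Perm (Fin n))
    (i : Fin k) (t : ℝ) : ℝ :=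
  reorderedEig H σ (Fin.castLE hkn i) t - lowMean hkn (H t)

/-- The signed standard deviation `sgn(t) ^ m * D_k(H(t))`. -/
def signedStdDev {n k : ℕ} (hkn : k ≤ n) (H : ℝ → Herm n) (m : ℕ) (t : ℝ) : ℝ :=
  Real.sign t ^ m * lowStdDev hkn (H t)

end EnergySplitting

end

/-! The first claim is Rellich's theorem for eigenvalues, which follows from a statement on
polynomials: a monic real-rooted polynomial with coefficients analytic in `t` has analytic roots
(`exists_analytic_roots`). The proof is by induction on the degree. Translate the roots so that
their mean is zero. The sum of their squares is analytic and nonnegative, so near 0 it is either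
identically zero, and all roots vanish, or `t ^ (2 * m) * u t` with `u 0 > 0`. In the second case
all roots are `O(t ^ m)`. Dividing them by `t ^ m` keeps the coefficients analytic and the
polynomial real-rooted, and at `t = 0` at least two distinct roots remain. The resulting coprime
factorization extends to nearby `t` by `exists_analytic_factorization`, and the factors have smaller
degree. Sorting the analytic branches on each side of 0 gives the permutation.

The order of an analytic function can be read off on `t > 0`, where the branches are sorted. There
the extreme splitting dominates every pair and mean splitting; conversely, it is a sum of adjacent
splittings and a difference of two mean splittings. The gap above the lowest `k` eigenvalues forces
every analytic reordering to permute them among themselves, so `D_k` is the root mean square of the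
analytic mean splittings. Taking `t ^ (2 * r)` out of the sum of squares leaves a function positive
at 0, and the sign factor turns `|t| ^ r` into `t ^ r`. -/

namespace EnergySplitting

open Polynomial Filter Topology
open scoped ContDiff

/-! ### Monic polynomials as coefficient vectors and the analytic Hensel lemma. -/

/-- The polynomial of degree `< a` with coefficient vector `v`. -/
noncomputable def lowPoly {a : ℕ} (v : Fin a → ℝ) : ℝ[X] := ∑ i : Fin a, monomial (i : ℕ) (v i)

/-- The monic polynomial of degree `a` with lower coefficient vector `v`. -/
noncomputable def monicPoly {a : ℕ} (v : Fin a → ℝ) : ℝ[X] := X ^ a + lowPoly v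

theorem coeff_lowPoly {a : ℕ} (v : Fin a → ℝ) (j : ℕ) :
    (lowPoly v).coeff j = if h : j < a then v ⟨j, h⟩ else 0 := by
  simp only [lowPoly, finsetSum_coeff, coeff_monomial]
  split_ifs with h
  · rw [Finset.sum_eq_single ⟨j, h⟩]
    · simp
    · intro b _ hb
      rw [if_neg]
      intro h'
      exact hb (Fin.ext h')
    · simp
  · refine Finset.sum_eq_zero fun i _ => if_neg ?_
    have := i.2
    omega

theorem degree_lowPoly_lt {a : ℕ} (v : Fin a → ℝ) : (lowPoly v).degree < a := by
  rw [degree_lt_iff_coeff_zero]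
  intro m hm
  rw [coeff_lowPoly, dif_neg (by omega)]

theorem monicPoly_monic {a : ℕ} (v : Fin a → ℝ) : (monicPoly v).Monic :=
  monic_X_pow_add (degree_lowPoly_lt v)

theorem natDegree_monicPoly {a : ℕ} (v : Fin a → ℝ) : (monicPoly v).natDegree = a := by
  have h : (monicPoly v).degree = a := by
    rw [monicPoly, degree_add_eq_left_of_degree_lt] <;> rw [degree_X_pow]
    exact degree_lowPoly_lt v
  exact natDegree_eq_of_degree_eq_some h

theorem coeff_monicPoly_of_lt {a : ℕ} (v : Fin a → ℝ) {j : ℕ} (h : j < a) :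
    (monicPoly v).coeff j = v ⟨j, h⟩ := by
  rw [monicPoly, coeff_add, coeff_X_pow, if_neg h.ne, coeff_lowPoly, dif_pos h, zero_add]

theorem eq_of_monic_of_coeff_eq {p q : ℝ[X]} {n : ℕ} (hp : p.Monic) (hq : q.Monic)
    (hpn : p.natDegree = n) (hqn : q.natDegree = n) (h : ∀ i < n, p.coeff i = q.coeff i) :
    p = q := by
  ext i
  rcases lt_trichotomy i n with hi | rfl | hi
  · exact h i hi
  · rw [← hpn, hp.coeff_natDegree, hpn, ← hqn, hq.coeff_natDegree]
  · rw [coeff_eq_zero_of_natDegree_lt (by omega), coeff_eq_zero_of_natDegree_lt (by omega)]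

theorem monicPoly_coeff {p : ℝ[X]} {n : ℕ} (hp : p.Monic) (hpn : p.natDegree = n) :
    monicPoly (fun i : Fin n => p.coeff i) = p :=
  eq_of_monic_of_coeff_eq (monicPoly_monic _) hp (natDegree_monicPoly _) hpn
    fun _ hi => coeff_monicPoly_of_lt _ hi

theorem lowPoly_eq_zero {a : ℕ} {v : Fin a → ℝ} (h : lowPoly v = 0) : v = 0 := by
  ext i
  have := coeff_lowPoly v i
  rw [h, dif_pos i.2] at this
  simpa using this.symm

/-- The `j`-th coefficient of `lowPoly v` as a linear functional of `v`. -/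
noncomputable def lowCoeff (a j : ℕ) : (Fin a → ℝ) →L[ℝ] ℝ :=
  if h : j < a then ContinuousLinearMap.proj ⟨j, h⟩ else 0

theorem lowCoeff_apply {a : ℕ} (j : ℕ) (v : Fin a → ℝ) : lowCoeff a j v = (lowPoly v).coeff j := by
  rw [coeff_lowPoly, lowCoeff]
  split_ifs <;> simp

/-- The lower coefficients of the product of two monic polynomials. -/
noncomputable def mulCoeffs (a b : ℕ) (x : (Fin a → ℝ) × (Fin b → ℝ)) : Fin (a + b) → ℝ :=
  fun i => (monicPoly x.1 * monicPoly x.2).coeff i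

theorem mulCoeffs_apply (a b : ℕ) (x : (Fin a → ℝ) × (Fin b → ℝ)) (i : Fin (a + b)) :
    mulCoeffs a b x i = ∑ d ∈ Finset.HasAntidiagonal.antidiagonal (i : ℕ),
      ((X ^ a : ℝ[X]).coeff d.1 + lowCoeff a d.1 x.1) *
        ((X ^ b : ℝ[X]).coeff d.2 + lowCoeff b d.2 x.2) := by
  simp only [mulCoeffs, coeff_mul, monicPoly, coeff_add, lowCoeff_apply]

theorem contDiff_mulCoeffs (a b : ℕ) : ContDiff ℝ ω (mulCoeffs a b) := by
  rw [contDiff_pi]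
  intro i
  simp only [mulCoeffs_apply]
  fun_prop

/-- The derivative of `mulCoeffs` at `x`, which is `(u, z) ↦ u * monicPoly x.2 + monicPoly x.1 * z`
on the level of polynomials. -/
noncomputable def mulCoeffsDeriv (a b : ℕ) (x : (Fin a → ℝ) × (Fin b → ℝ)) :
    ((Fin a → ℝ) × (Fin b → ℝ)) →L[ℝ] (Fin (a + b) → ℝ) :=
  ContinuousLinearMap.pi fun i => ∑ d ∈ Finset.HasAntidiagonal.antidiagonal (i : ℕ),
    (((monicPoly x.1).coeff d.1) • (lowCoeff b d.2).comp (ContinuousLinearMap.snd ℝ _ _) +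
      ((monicPoly x.2).coeff d.2) • (lowCoeff a d.1).comp (ContinuousLinearMap.fst ℝ _ _))

theorem mulCoeffsDeriv_apply (a b : ℕ) (x y : (Fin a → ℝ) × (Fin b → ℝ)) (i : Fin (a + b)) :
    mulCoeffsDeriv a b x y i =
      (monicPoly x.1 * lowPoly y.2 + lowPoly y.1 * monicPoly x.2).coeff i := by
  simp [mulCoeffsDeriv, coeff_mul, lowCoeff_apply, Finset.sum_add_distrib,
    mul_comm ((lowPoly y.1).coeff _)]

theorem hasFDerivAt_mulCoeffs (a b : ℕ) (x : (Fin a → ℝ) × (Fin b → ℝ)) :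
    HasFDerivAt (mulCoeffs a b) (mulCoeffsDeriv a b x) x := by
  rw [hasFDerivAt_pi']
  intro i
  simp only [mulCoeffs_apply]
  have h1 : ∀ d : ℕ × ℕ, HasFDerivAt
      (fun x : (Fin a → ℝ) × (Fin b → ℝ) => (X ^ a : ℝ[X]).coeff d.1 + lowCoeff a d.1 x.1)
      ((lowCoeff a d.1).comp (ContinuousLinearMap.fst ℝ _ _)) x := fun d =>
    HasFDerivAt.const_add _
      ((lowCoeff a d.1).comp (ContinuousLinearMap.fst ℝ (Fin a → ℝ) (Fin b → ℝ))).hasFDerivAt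
  have h2 : ∀ d : ℕ × ℕ, HasFDerivAt
      (fun x : (Fin a → ℝ) × (Fin b → ℝ) => (X ^ b : ℝ[X]).coeff d.2 + lowCoeff b d.2 x.2)
      ((lowCoeff b d.2).comp (ContinuousLinearMap.snd ℝ _ _)) x := fun d =>
    HasFDerivAt.const_add _
      ((lowCoeff b d.2).comp (ContinuousLinearMap.snd ℝ (Fin a → ℝ) (Fin b → ℝ))).hasFDerivAt
  refine (HasFDerivAt.fun_sum fun d _ => (h1 d).mul (h2 d)).congr_fderiv ?_
  ext y <;> simp [mulCoeffsDeriv, monicPoly, lowCoeff_apply]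

/-- If `f * z + u * g = 0` with `f`, `g` coprime, then `f ∣ u`. Since `deg u < deg f`, this gives `u
= 0` and hence `z = 0`. -/
theorem mulCoeffsDeriv_injective {a b : ℕ} {x : (Fin a → ℝ) × (Fin b → ℝ)}
    (hx : IsCoprime (monicPoly x.1) (monicPoly x.2)) :
    Function.Injective (mulCoeffsDeriv a b x) := by
  rw [injective_iff_map_eq_zero]
  rintro ⟨u, z⟩ h
  have hdeg : (monicPoly x.1 * lowPoly z + lowPoly u * monicPoly x.2).degree < ((a + b : ℕ)) := by
    refine (degree_add_le _ _).trans_lt (max_lt ?_ ?_)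
    · rw [degree_mul, degree_eq_natDegree (monicPoly_monic _).ne_zero, natDegree_monicPoly,
        Nat.cast_add]
      exact WithBot.add_lt_add_left (by simp) (degree_lowPoly_lt z)
    · rw [degree_mul, degree_eq_natDegree (monicPoly_monic x.2).ne_zero, natDegree_monicPoly,
        Nat.cast_add]
      exact WithBot.add_lt_add_right (by simp) (degree_lowPoly_lt u)
  have h0 : monicPoly x.1 * lowPoly z + lowPoly u * monicPoly x.2 = 0 := by
    ext j
    by_cases hj : j < a + b
    · have := congrFun h ⟨j, hj⟩
      rwa [mulCoeffsDeriv_apply] at this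
    · rw [coeff_zero]
      exact (degree_lt_iff_coeff_zero _ _).1 hdeg j (by omega)
  have hu : lowPoly u = 0 := by
    refine eq_zero_of_dvd_of_degree_lt (p := monicPoly x.1) ?_ ?_
    · refine hx.dvd_of_dvd_mul_right ⟨-lowPoly z, ?_⟩
      linear_combination h0
    · rw [degree_eq_natDegree (monicPoly_monic _).ne_zero, natDegree_monicPoly]
      exact degree_lowPoly_lt u
  have hz : lowPoly z = 0 := by
    rw [hu, zero_mul, add_zero] at h0
    exact (mul_eq_zero.1 h0).resolve_left (monicPoly_monic _).ne_zero
  rw [lowPoly_eq_zero hu, lowPoly_eq_zero hz]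
  rfl

/-- Analytic Hensel lemma: a coprime factorization at `0` extends to an analytic one nearby. -/
theorem exists_analytic_factorization {a b : ℕ} {p : ℝ → ℝ[X]} (hm : ∀ t, (p t).Monic)
    (hd : ∀ t, (p t).natDegree = a + b) (ha : ∀ i, AnalyticAt ℝ (fun t => (p t).coeff i) 0)
    {f g : ℝ[X]} (hf : f.Monic) (hg : g.Monic) (hfa : f.natDegree = a) (hgb : g.natDegree = b)
    (hfg : IsCoprime f g) (h0 : p 0 = f * g) :
    ∃ (v : ℝ → Fin a → ℝ) (w : ℝ → Fin b → ℝ), AnalyticAt ℝ v 0 ∧ AnalyticAt ℝ w 0 ∧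
      ∀ᶠ t in 𝓝 0, p t = monicPoly (v t) * monicPoly (w t) := by
  set x : (Fin a → ℝ) × (Fin b → ℝ) := (fun i => f.coeff i, fun i => g.coeff i) with hx
  have hx1 : monicPoly x.1 = f := monicPoly_coeff hf hfa
  have hx2 : monicPoly x.2 = g := monicPoly_coeff hg hgb
  have hinj := mulCoeffsDeriv_injective (x := x) (by rwa [hx1, hx2])
  -- Source and target both have dimension `a + b`, so injectivity is all that the inverse function
  -- theorem needs.
  let e : ((Fin a → ℝ) × (Fin b → ℝ)) ≃L[ℝ] (Fin (a + b) → ℝ) :=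
    (LinearEquiv.ofInjectiveOfFinrankEq (mulCoeffsDeriv a b x).toLinearMap hinj
      (by simp)).toContinuousLinearEquiv
  have he : (e : _ →L[ℝ] _) = mulCoeffsDeriv a b x := by
    refine ContinuousLinearMap.ext fun y => ?_
    rfl
  have hder : HasFDerivAt (mulCoeffs a b) (e : _ →L[ℝ] _) x := by
    rw [he]
    exact hasFDerivAt_mulCoeffs a b x
  have hc : ContDiffAt ℝ ω (mulCoeffs a b) x := (contDiff_mulCoeffs a b).contDiffAt
  have hω : (ω : WithTop ℕ∞) ≠ 0 := by simp
  let y : ℝ → Fin (a + b) → ℝ := fun t i => (p t).coeff i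
  have hy : AnalyticAt ℝ y 0 := analyticAt_pi_iff.2 fun i => ha i
  have hy0 : y 0 = mulCoeffs a b x := by
    funext i
    simp only [y, mulCoeffs, hx1, hx2, h0]
  have hg' : AnalyticAt ℝ (hc.localInverse hder hω) (y 0) := by
    rw [hy0]
    exact (hc.to_localInverse hder hω).analyticAt
  have hG := hg'.comp hy
  refine ⟨fun t => (hc.localInverse hder hω (y t)).1, fun t => (hc.localInverse hder hω (y t)).2,
    ?_, ?_, ?_⟩
  · exact (ContinuousLinearMap.fst ℝ _ _).analyticAt _ |>.comp hG
  · exact (ContinuousLinearMap.snd ℝ _ _).analyticAt _ |>.comp hG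
  · have hr := (hc.hasStrictFDerivAt' hder hω).eventually_right_inverse
    rw [← hy0] at hr
    filter_upwards [hy.continuousAt.eventually hr] with t ht
    refine eq_of_monic_of_coeff_eq (hm t) ((monicPoly_monic _).mul (monicPoly_monic _)) (hd t) ?_ ?_
    · rw [Monic.natDegree_mul (monicPoly_monic _) (monicPoly_monic _), natDegree_monicPoly,
        natDegree_monicPoly]
    · intro i hi
      exact (congrFun ht ⟨i, hi⟩).symm

/-! ### Orders of vanishing from growth and sign. -/

/-- If the order were `m < n`, then `f t / t ^ m` would have a nonzero limit from the right, yet be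
bounded there by a multiple of `t ^ (n - m)`. -/
theorem le_analyticOrderAt_of_isBigO {f : ℝ → ℝ} (hf : AnalyticAt ℝ f 0) {n : ℕ}
    (h : f =O[𝓝[>] 0] fun t => t ^ n) : (n : ℕ∞) ≤ analyticOrderAt f 0 := by
  by_contra! hlt
  obtain ⟨m, hm⟩ := ENat.ne_top_iff_exists.1 hlt.ne_top
  rw [← hm, Nat.cast_lt] at hlt
  obtain ⟨u, hu, hu0, hfu⟩ := (hf.analyticOrderAt_eq_natCast).1 hm.symm
  obtain ⟨C, hC⟩ := h.bound
  have hpos : ∀ᶠ t : ℝ in 𝓝[>] 0, 0 < t := eventually_mem_nhdsWithin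
  have hle : ∀ᶠ t : ℝ in 𝓝[>] 0, |u t| ≤ C * t ^ (n - m) := by
    filter_upwards [hpos, hC, hfu.filter_mono nhdsWithin_le_nhds] with t ht h1 h2
    rw [h2, sub_zero, smul_eq_mul, Real.norm_eq_abs, Real.norm_eq_abs, abs_mul, abs_pow, abs_pow,
      abs_of_pos ht] at h1
    have htm : 0 < t ^ m := pow_pos ht m
    refine le_of_mul_le_mul_left ?_ htm
    calc t ^ m * |u t| ≤ C * t ^ n := h1
      _ = t ^ m * (C * t ^ (n - m)) := by
        rw [mul_left_comm, ← pow_add, Nat.add_sub_cancel' hlt.le]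
  have h1 : Tendsto (fun t => |u t|) (𝓝[>] 0) (𝓝 |u 0|) :=
    (hu.continuousAt.abs.tendsto).mono_left nhdsWithin_le_nhds
  have h2 : Tendsto (fun t : ℝ => C * t ^ (n - m)) (𝓝[>] 0) (𝓝 (C * 0 ^ (n - m))) := by
    have : Continuous fun t : ℝ => C * t ^ (n - m) := by fun_prop
    exact (this.tendsto 0).mono_left nhdsWithin_le_nhds
  have h3 := le_of_tendsto_of_tendsto h1 h2 hle
  rw [zero_pow (by omega), mul_zero] at h3
  exact hu0 (abs_nonpos_iff.1 h3)

theorem exists_eq_pow_mul_of_isBigO {f : ℝ → ℝ} (hf : AnalyticAt ℝ f 0) {n : ℕ}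
    (h : f =O[𝓝[>] 0] fun t => t ^ n) :
    ∃ g : ℝ → ℝ, AnalyticAt ℝ g 0 ∧ ∀ᶠ t in 𝓝 0, f t = t ^ n * g t := by
  simpa using (natCast_le_analyticOrderAt hf).1 (le_analyticOrderAt_of_isBigO hf h)

/-- A function of odd order changes sign at 0. -/
theorem eventually_zero_or_exists_even_order {S : ℝ → ℝ} (hS : AnalyticAt ℝ S 0)
    (h : ∀ᶠ t in 𝓝 0, 0 ≤ S t) : (∀ᶠ t in 𝓝 0, S t = 0) ∨
      ∃ (m : ℕ) (u : ℝ → ℝ), AnalyticAt ℝ u 0 ∧ 0 < u 0 ∧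
        ∀ᶠ t in 𝓝 0, S t = (t ^ m) ^ 2 * u t := by
  rcases eq_or_ne (analyticOrderAt S 0) ⊤ with htop | hne
  · exact Or.inl (analyticOrderAt_eq_top.1 htop)
  right
  obtain ⟨u, hu, hu0, hSu⟩ := hS.analyticOrderAt_ne_top.1 hne
  set e := analyticOrderNatAt S 0
  simp only [sub_zero, smul_eq_mul] at hSu
  have hright : 0 ≤ u 0 := by
    refine ge_of_tendsto (hu.continuousAt.tendsto.mono_left
      (nhdsWithin_le_nhds (s := Set.Ioi 0))) ?_
    filter_upwards [eventually_mem_nhdsWithin, hSu.filter_mono nhdsWithin_le_nhds,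
      h.filter_mono nhdsWithin_le_nhds] with t (ht : 0 < t) h1 h2
    rw [h1] at h2
    exact nonneg_of_mul_nonneg_right h2 (pow_pos ht e)
  have hpos : 0 < u 0 := lt_of_le_of_ne hright (Ne.symm hu0)
  have heven : Even e := by
    by_contra hodd
    rw [Nat.not_even_iff_odd] at hodd
    have : u 0 ≤ 0 := by
      refine le_of_tendsto (hu.continuousAt.tendsto.mono_left
        (nhdsWithin_le_nhds (s := Set.Iio 0))) ?_
      filter_upwards [eventually_mem_nhdsWithin, hSu.filter_mono nhdsWithin_le_nhds,
        h.filter_mono nhdsWithin_le_nhds] with t (ht : t < 0) h1 h2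
      rw [h1] at h2
      by_contra! hc
      exact absurd h2 (not_le.2 (mul_neg_of_neg_of_pos (hodd.pow_neg ht) hc))
    linarith
  obtain ⟨m, hm⟩ := heven
  refine ⟨m, u, hu, hpos, ?_⟩
  filter_upwards [hSu] with t ht
  rw [ht, hm, ← pow_mul, mul_two]

/-! ### Real-rooted polynomials. -/

theorem sum_sq_eq_esymm {R : Type*} [CommRing R] (s : Multiset R) :
    (s.map (· ^ 2)).sum = s.sum ^ 2 - 2 * s.esymm 2 := by
  induction s using Multiset.induction_on with
  | empty => simp [Multiset.esymm, Multiset.powersetCard_zero_right]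
  | cons a s ih =>
    have h : (a ::ₘ s).esymm 2 = s.esymm 2 + a * s.sum := by
      simp [Multiset.esymm, Multiset.powersetCard_cons, Multiset.powersetCard_one]
      simpa using Multiset.sum_map_mul_left (s := s) (a := a) (f := id)
    rw [Multiset.map_cons, Multiset.sum_cons, Multiset.sum_cons, ih, h]
    ring

theorem sum_roots_eq {p : ℝ[X]} {n : ℕ} (hp : p.Monic) (hd : p.natDegree = n + 2)
    (hs : p.Splits) : p.roots.sum = -p.coeff (n + 1) := by
  have h := hs.nextCoeff_eq_neg_sum_roots_of_monic hp
  rw [nextCoeff_of_natDegree_pos (by omega), hd] at h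
  rw [show n + 1 = n + 2 - 1 by omega, h, neg_neg]

theorem sum_sq_roots_eq {p : ℝ[X]} {n : ℕ} (hp : p.Monic) (hd : p.natDegree = n + 2)
    (hs : p.Splits) :
    (p.roots.map (· ^ 2)).sum = p.coeff (n + 1) ^ 2 - 2 * p.coeff n := by
  have h := coeff_eq_esymm_roots_of_card (splits_iff_card_roots.1 hs) (k := n) (by omega)
  rw [hp.leadingCoeff, hd, Nat.add_sub_cancel_left] at h
  rw [sum_sq_eq_esymm, sum_roots_eq hp hd hs, h]
  ring

theorem sq_le_sum_sq {s : Multiset ℝ} {x : ℝ} (hx : x ∈ s) : x ^ 2 ≤ (s.map (· ^ 2)).sum := by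
  refine Multiset.single_le_sum ?_ _ (Multiset.mem_map_of_mem _ hx)
  intro y hy
  obtain ⟨z, -, rfl⟩ := Multiset.mem_map.1 hy
  positivity

/-- Each factor satisfies `‖z - x‖ ≥ |z.im|` for real `x`. The bound depends only on the degree, so
it survives limits and excludes nonreal roots there. -/
theorem pow_abs_im_le_norm_aeval (z : ℂ) (s : Multiset ℝ) :
    |z.im| ^ s.card ≤ ‖aeval z (s.map fun x => X - C x).prod‖ := by
  induction s using Multiset.induction_on with
  | empty => simp
  | cons a s ih =>
    rw [Multiset.map_cons, Multiset.prod_cons, map_mul, norm_mul, Multiset.card_cons, pow_succ']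
    refine mul_le_mul ?_ ih (by positivity) (norm_nonneg _)
    simpa using Complex.abs_im_le_norm (z - a)

/-- A limit of monic real-rooted polynomials of fixed degree is real-rooted. -/
theorem splits_of_eventually_splits {p : ℝ → ℝ[X]} {n : ℕ} (hm : ∀ t, (p t).Monic)
    (hd : ∀ t, (p t).natDegree = n) (hc : ∀ i, ContinuousAt (fun t => (p t).coeff i) 0)
    (hs : ∀ᶠ t in 𝓝[≠] 0, (p t).Splits) : (p 0).Splits := by
  refine Splits.of_splits_map_of_injective (i := Complex.ofRealHom) Complex.ofRealHom.injective
    (IsAlgClosed.splits _) ?_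
  intro z hz
  have hz0 : aeval z (p 0) = 0 := by
    have := (mem_roots'.1 hz).2
    rwa [IsRoot.def, eval_map] at this
  have hcont : ContinuousAt (fun t => ‖aeval z (p t)‖) 0 := by
    refine ContinuousAt.norm ?_
    have : ∀ t, aeval z (p t) = ∑ i ∈ Finset.range (n + 1), (p t).coeff i • z ^ i := fun t => by
      rw [aeval_eq_sum_range, hd]
    simp only [this]
    exact tendsto_finsetSum _ fun i _ => (hc i).smul continuousAt_const
  have hlow : ∀ᶠ t in 𝓝[≠] 0, |z.im| ^ n ≤ ‖aeval z (p t)‖ := by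
    filter_upwards [hs] with t ht
    have h := pow_abs_im_le_norm_aeval z (p t).roots
    rwa [← ht.eq_prod_roots_of_monic (hm t), splits_iff_card_roots.1 ht, hd] at h
  have := ge_of_tendsto (hcont.tendsto.mono_left nhdsWithin_le_nhds) hlow
  rw [hz0, norm_zero] at this
  have him : z.im = 0 := by
    by_contra hne
    exact absurd this (not_le.2 (pow_pos (abs_pos.2 hne) n))
  exact ⟨z.re, by apply Complex.ext <;> simp [him]⟩

theorem scaleRoots_listProd (L : List (ℝ → ℝ)) (t s : ℝ) :
    ((L.map fun μ => X - C (μ t)).prod : ℝ[X]).scaleRoots s =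
      (L.map fun μ => X - C (s * μ t)).prod := by
  induction L with
  | nil => simp
  | cons a L ih =>
    rw [List.map_cons, List.prod_cons, mul_scaleRoots_of_noZeroDivisors, ih, X_sub_C_scaleRoots,
      List.map_cons, List.prod_cons, mul_comm s]

theorem analyticAt_coeff_monicPoly {a : ℕ} {v : ℝ → Fin a → ℝ} (hv : AnalyticAt ℝ v 0) (i : ℕ) :
    AnalyticAt ℝ (fun t => (monicPoly (v t)).coeff i) 0 := by
  simp only [monicPoly, coeff_add, ← lowCoeff_apply]
  exact analyticAt_const.add (((lowCoeff a i).analyticAt _).comp hv)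

/-- The roots have sum zero but a nonzero sum of squares, so they are not all equal. Splitting off
the full power of one root leaves a nonconstant coprime cofactor. -/
theorem exists_coprime_factor {p : ℝ[X]} {n : ℕ} (hp : p.Monic) (hd : p.natDegree = n + 2)
    (hs : p.Splits) (h1 : p.coeff (n + 1) = 0) (h2 : p.coeff n ≠ 0) :
    ∃ f g : ℝ[X], f.Monic ∧ g.Monic ∧ 0 < f.natDegree ∧ 0 < g.natDegree ∧
      f.natDegree + g.natDegree = n + 2 ∧ IsCoprime f g ∧ p = f * g := by
  obtain ⟨x, hx⟩ := Multiset.exists_mem_of_ne_zero (hs.roots_ne_zero (by omega))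
  obtain ⟨g, hg, hgx⟩ := exists_eq_pow_rootMultiplicity_mul_and_not_dvd p hp.ne_zero x
  set k := p.rootMultiplicity x with hk
  have hf : ((X - C x) ^ k).Monic := (monic_X_sub_C x).pow k
  have hgm : g.Monic := hf.of_mul_monic_left (hg ▸ hp)
  have hdeg : ((X - C x) ^ k).natDegree + g.natDegree = n + 2 := by
    rw [← hf.natDegree_mul hgm, ← hg, hd]
  have hfk : ((X - C x) ^ k).natDegree = k := by simp
  refine ⟨(X - C x) ^ k, g, hf, hgm, ?_, ?_, hdeg, ?_, hg⟩
  · rw [hfk]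
    exact (rootMultiplicity_pos hp.ne_zero).2 ((mem_roots hp.ne_zero).1 hx)
  · by_contra h0
    have hg1 : g = 1 := hgm.natDegree_eq_zero.1 (by omega)
    have hroots : p.roots = Multiset.replicate k x := by
      rw [hg, hg1, mul_one, roots_pow, roots_X_sub_C, Multiset.nsmul_singleton]
    have hsum := sum_roots_eq hp hd hs
    have hsq := sum_sq_roots_eq hp hd hs
    rw [hroots, h1, Multiset.sum_replicate, neg_zero, nsmul_eq_mul] at hsum
    rw [hroots, h1, Multiset.map_replicate, Multiset.sum_replicate, nsmul_eq_mul] at hsq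
    apply h2
    linear_combination (1 / 2 : ℝ) * hsq - x / 2 * hsum
  · exact (((irreducible_X_sub_C x).coprime_iff_not_dvd).2 hgx).pow_left

/-! ### Analytic roots of real-rooted families. -/

/-- The induction step for monic real-rooted families whose roots have mean zero. -/
theorem exists_analytic_roots_of_centered {n : ℕ}
    (ih : ∀ a < n + 2, ∀ p : ℝ → ℝ[X], (∀ t, (p t).Monic) → (∀ t, (p t).natDegree = a) →
      (∀ i, AnalyticAt ℝ (fun t => (p t).coeff i) 0) → (∀ᶠ t in 𝓝 0, (p t).Splits) →
      ∃ L : List (ℝ → ℝ), (∀ μ ∈ L, AnalyticAt ℝ μ 0) ∧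
        ∀ᶠ t in 𝓝 0, p t = (L.map fun μ => X - C (μ t)).prod)
    {q : ℝ → ℝ[X]} (hm : ∀ t, (q t).Monic) (hd : ∀ t, (q t).natDegree = n + 2)
    (ha : ∀ i, AnalyticAt ℝ (fun t => (q t).coeff i) 0) (hs : ∀ᶠ t in 𝓝 0, (q t).Splits)
    (h1 : ∀ t, (q t).coeff (n + 1) = 0) :
    ∃ L : List (ℝ → ℝ), (∀ μ ∈ L, AnalyticAt ℝ μ 0) ∧
      ∀ᶠ t in 𝓝 0, q t = (L.map fun μ => X - C (μ t)).prod := by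
  have hS : ∀ᶠ t in 𝓝 0, ((q t).roots.map (· ^ 2)).sum = -2 * (q t).coeff n := by
    filter_upwards [hs] with t ht
    rw [sum_sq_roots_eq (hm t) (hd t) ht, h1]
    ring
  have hSa : AnalyticAt ℝ (fun t => -2 * (q t).coeff n) 0 := analyticAt_const.mul (ha n)
  have hS0 : ∀ᶠ t in 𝓝 0, 0 ≤ -2 * (q t).coeff n := by
    filter_upwards [hS] with t ht
    rw [← ht]
    refine Multiset.sum_nonneg fun y hy => ?_
    obtain ⟨z, -, rfl⟩ := Multiset.mem_map.1 hy
    positivity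
  rcases eventually_zero_or_exists_even_order hSa hS0 with hz | ⟨m, u, hu, hu0, hSu⟩
  · refine ⟨List.replicate (n + 2) fun _ => 0, ?_, ?_⟩
    · intro μ hμ
      rw [List.eq_of_mem_replicate hμ]
      exact analyticAt_const
    · filter_upwards [hz, hS, hs] with t h2 h3 h4
      have hr : (q t).roots = Multiset.replicate (n + 2) 0 := by
        rw [Multiset.eq_replicate]
        refine ⟨by rw [splits_iff_card_roots.1 h4, hd], fun x hx => ?_⟩
        have := sq_le_sum_sq hx
        rw [h3, h2] at this
        exact pow_eq_zero_iff (two_ne_zero) |>.1 (le_antisymm this (sq_nonneg x))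
      rw [h4.eq_prod_roots_of_monic (hm t), hr]
      simp [pow_succ']
  have hub : ∀ᶠ t in 𝓝 0, u t ≤ u 0 + 1 :=
    (hu.continuousAt.eventually_lt continuousAt_const (by linarith)).mono fun t ht => ht.le
  set B := Real.sqrt (u 0 + 1) with hB
  have hB2 : B ^ 2 = u 0 + 1 := Real.sq_sqrt (by linarith)
  have hB0 : 0 ≤ B := Real.sqrt_nonneg _
  -- Every root is at most `B * |t| ^ m` in absolute value, and the coefficient of index `i` is
  -- homogeneous of degree `n + 2 - i` in the roots.
  have hO : ∀ i : ℕ, (fun t => (q t).coeff i) =O[𝓝[>] 0] fun t => t ^ (m * (n + 2 - i)) := by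
    intro i
    refine Asymptotics.IsBigO.of_bound (B ^ (n + 2 - i) * (n + 2).choose i) ?_
    refine Eventually.filter_mono nhdsWithin_le_nhds ?_
    filter_upwards [hs, hS, hSu, hub] with t h2 h3 h4 h5
    have hroots : ∀ x ∈ (q t).roots, ‖x‖ ≤ |t| ^ m * B := by
      intro x hx
      rw [Real.norm_eq_abs]
      refine abs_le_of_sq_le_sq ?_ (by positivity)
      calc x ^ 2 ≤ _ := sq_le_sum_sq hx
        _ = (t ^ m) ^ 2 * u t := by rw [h3, h4]
        _ ≤ (t ^ m) ^ 2 * (u 0 + 1) := by gcongr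
        _ = (|t| ^ m * B) ^ 2 := by rw [mul_pow, hB2, ← abs_pow, sq_abs]
    have := coeff_le_of_roots_le (f := RingHom.id ℝ) i (hm t) (by simpa using h2)
      (B := |t| ^ m * B) (by simpa using hroots)
    rw [Polynomial.map_id, hd] at this
    refine this.trans_eq ?_
    rw [norm_pow, Real.norm_eq_abs, mul_pow, ← pow_mul]
    ring
  choose b hba hb using fun i => exists_eq_pow_mul_of_isBigO (ha i) (hO i)
  set v : ℝ → Fin (n + 2) → ℝ := fun t i => b i t with hv
  have hva : AnalyticAt ℝ v 0 := analyticAt_pi_iff.2 fun i => hba i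
  have hrm : ∀ t, (monicPoly (v t)).Monic := fun t => monicPoly_monic _
  have hrd : ∀ t, (monicPoly (v t)).natDegree = n + 2 := fun t => natDegree_monicPoly _
  have hra := analyticAt_coeff_monicPoly hva
  have hscale : ∀ᶠ t in 𝓝 0, (monicPoly (v t)).scaleRoots (t ^ m) = q t := by
    have hb' : ∀ᶠ t in 𝓝 0, ∀ i : Fin (n + 2),
        (q t).coeff i = t ^ (m * (n + 2 - i)) * b i t := eventually_all.2 fun i => hb i
    filter_upwards [hb'] with t ht
    refine eq_of_monic_of_coeff_eq ((monic_scaleRoots_iff _).2 (hrm t)) (hm t)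
      (by rw [natDegree_scaleRoots, hrd]) (hd t) fun i hi => ?_
    rw [coeff_scaleRoots, coeff_monicPoly_of_lt _ hi, hrd, ht ⟨i, hi⟩, ← pow_mul, mul_comm]
  -- For `t ≠ 0` the roots of the new polynomial are those of `q t` divided by `t ^ m`;
  -- real-rootedness at `t = 0` needs the limit argument.
  have hrs' : ∀ᶠ t in 𝓝[≠] 0, (monicPoly (v t)).Splits := by
    filter_upwards [hscale.filter_mono nhdsWithin_le_nhds, hs.filter_mono nhdsWithin_le_nhds,
      eventually_mem_nhdsWithin] with t h2 h3 (h4 : t ≠ 0)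
    have h5 := h3.scaleRoots ((t ^ m)⁻¹)
    rwa [← h2, ← scaleRoots_mul, mul_inv_cancel₀ (pow_ne_zero m h4), scaleRoots_one] at h5
  have hr0 : (monicPoly (v 0)).Splits :=
    splits_of_eventually_splits hrm hrd (fun i => (hra i).continuousAt) hrs'
  have hrs : ∀ᶠ t in 𝓝 0, (monicPoly (v t)).Splits := by
    rw [eventually_nhdsWithin_iff] at hrs'
    filter_upwards [hrs'] with t ht
    rcases eq_or_ne t 0 with rfl | h
    · exact hr0
    · exact ht h
  have hc1 : (monicPoly (v 0)).coeff (n + 1) = 0 := by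
    refine tendsto_nhds_unique_of_eventuallyEq (l := 𝓝[≠] (0 : ℝ))
      ((hra (n + 1)).continuousAt.tendsto.mono_left nhdsWithin_le_nhds)
      (tendsto_const_nhds) ?_
    filter_upwards [(hb (n + 1)).filter_mono nhdsWithin_le_nhds,
      eventually_mem_nhdsWithin] with t h2 (h4 : t ≠ 0)
    rw [h1, eq_comm, mul_eq_zero] at h2
    rw [coeff_monicPoly_of_lt _ (by omega)]
    exact h2.resolve_left (pow_ne_zero _ h4)
  -- The choice of `m` makes this coefficient nonzero, so the rescaled roots do not all coincide at
  -- `t = 0`.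
  have hc2 : (monicPoly (v 0)).coeff n = - u 0 / 2 := by
    refine tendsto_nhds_unique_of_eventuallyEq (l := 𝓝[≠] (0 : ℝ))
      ((hra n).continuousAt.tendsto.mono_left nhdsWithin_le_nhds)
      ((hu.continuousAt.tendsto.neg.div_const 2).mono_left nhdsWithin_le_nhds) ?_
    filter_upwards [(hb n).filter_mono nhdsWithin_le_nhds, hSu.filter_mono nhdsWithin_le_nhds,
      eventually_mem_nhdsWithin] with t h2 h3 (h4 : t ≠ 0)
    rw [coeff_monicPoly_of_lt _ (by omega)]
    rw [h2, Nat.add_sub_cancel_left, pow_mul] at h3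
    have h5 : (t ^ m) ^ 2 ≠ 0 := pow_ne_zero _ (pow_ne_zero _ h4)
    have h6 : -2 * b n t = u t := mul_left_cancel₀ h5 (by linear_combination h3)
    change b n t = -u t / 2
    linarith
  obtain ⟨f, g, hfm, hgm, hf0, hg0, hfg, hcop, hprod⟩ :=
    exists_coprime_factor (hrm 0) (hrd 0) hr0 hc1 (by rw [hc2]; linarith [hu0] |> ne_of_lt)
  obtain ⟨x, y, hxa, hya, hxy⟩ := exists_analytic_factorization (a := f.natDegree)
    (b := g.natDegree) hrm (fun t => by rw [hrd, hfg]) hra hfm hgm rfl rfl hcop hprod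
  have hsplit : ∀ᶠ t in 𝓝 0, (monicPoly (x t)).Splits ∧ (monicPoly (y t)).Splits := by
    filter_upwards [hxy, hrs] with t h2 h3
    rw [h2] at h3
    exact (splits_mul (monicPoly_monic _).ne_zero (monicPoly_monic _).ne_zero).1 h3
  obtain ⟨L₁, hL₁, hL₁'⟩ := ih f.natDegree (by omega) (fun t => monicPoly (x t))
    (fun t => monicPoly_monic _) (fun t => natDegree_monicPoly _)
    (analyticAt_coeff_monicPoly hxa) (hsplit.mono fun t h => h.1)
  obtain ⟨L₂, hL₂, hL₂'⟩ := ih g.natDegree (by omega) (fun t => monicPoly (y t))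
    (fun t => monicPoly_monic _) (fun t => natDegree_monicPoly _)
    (analyticAt_coeff_monicPoly hya) (hsplit.mono fun t h => h.2)
  refine ⟨(L₁ ++ L₂).map fun ρ t => t ^ m * ρ t, ?_, ?_⟩
  · intro μ hμ
    obtain ⟨ρ, hρ, rfl⟩ := List.mem_map.1 hμ
    refine (analyticAt_id.pow m).mul ?_
    rcases List.mem_append.1 hρ with h | h
    · exact hL₁ ρ h
    · exact hL₂ ρ h
  · filter_upwards [hscale, hxy, hL₁', hL₂'] with t h2 h3 h4 h5
    rw [← h2, h3, h4, h5, ← List.prod_append, ← List.map_append, scaleRoots_listProd, List.map_map]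
    rfl

/-- A monic real-rooted polynomial with analytic coefficients has analytic roots. -/
theorem exists_analytic_roots (n : ℕ) : ∀ p : ℝ → ℝ[X], (∀ t, (p t).Monic) →
    (∀ t, (p t).natDegree = n) → (∀ i, AnalyticAt ℝ (fun t => (p t).coeff i) 0) →
    (∀ᶠ t in 𝓝 0, (p t).Splits) →
    ∃ L : List (ℝ → ℝ), (∀ μ ∈ L, AnalyticAt ℝ μ 0) ∧
      ∀ᶠ t in 𝓝 0, p t = (L.map fun μ => X - C (μ t)).prod := by
  induction n using Nat.strong_induction_on with
  | _ n ih =>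
  intro p hm hd ha hs
  match n with
  | 0 => exact ⟨[], by simp, Eventually.of_forall fun t => by
      simpa using (hm t).natDegree_eq_zero.1 (hd t)⟩
  | 1 =>
    refine ⟨[fun t => -(p t).coeff 0], by simpa only [List.mem_singleton, forall_eq] using (ha 0).fun_neg,
      Eventually.of_forall fun t => ?_⟩
    simpa using (hm t).eq_X_add_C (hd t)
  | n + 2 =>
    -- The mean of the roots; translating by it removes the coefficient of index `n + 1`.
    set c : ℝ → ℝ := fun t => -(p t).coeff (n + 1) / (n + 2) with hc
    have hca : AnalyticAt ℝ c 0 := (ha (n + 1)).neg.div_const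
    have hdX : ∀ t, (X + C (c t)).natDegree = 1 := fun t => natDegree_X_add_C _
    have hcoeff : ∀ t i, ((p t).comp (X + C (c t))).coeff i =
        ∑ j ∈ Finset.range (n + 3), (p t).coeff j * (c t ^ (j - i) * (j.choose i : ℝ)) := by
      intro t i
      rw [comp, eval₂_eq_sum_range, hd, finsetSum_coeff]
      simp only [coeff_C_mul, coeff_X_add_C_pow]
    obtain ⟨L, hL, hL'⟩ := exists_analytic_roots_of_centered ih
      (q := fun t => (p t).comp (X + C (c t)))
      (fun t => (hm t).comp (monic_X_add_C _) (by simp))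
      (fun t => by rw [natDegree_comp, hd, hdX, mul_one])
      (fun i => by
        simp only [hcoeff]
        exact Finset.analyticAt_fun_sum _ fun j _ =>
          (ha j).mul ((hca.pow _).mul analyticAt_const))
      (hs.mono fun t ht => ht.comp_X_add_C _)
      (fun t => by
        have h1 : (p t).coeff (n + 2) = 1 := by rw [← hd t, (hm t).coeff_natDegree]
        rw [hcoeff, Finset.sum_range_succ, Finset.sum_range_succ, Finset.sum_eq_zero]
        · have : (n : ℝ) + 2 ≠ 0 := by positivity
          simp [h1, hc, Nat.choose_succ_self_right]
          field_simp
          ring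
        · intro j hj
          rw [Nat.choose_eq_zero_of_lt (by simpa using hj)]
          simp)
    refine ⟨L.map fun μ t => μ t + c t, ?_, ?_⟩
    · intro μ hμ
      obtain ⟨ρ, hρ, rfl⟩ := List.mem_map.1 hμ
      exact (hL ρ hρ).add hca
    · filter_upwards [hL'] with t ht
      have h2 : p t = ((p t).comp (X + C (c t))).comp (X - C (c t)) := by
        rw [comp_assoc]
        simp
      rw [h2, ht, ← coe_compRingHom_apply, map_list_prod, List.map_map, List.map_map]
      congr 2
      funext μ
      simp [sub_sub, add_comm]

/-! ### Analytic eigenvalue branches and Rellich's theorem. -/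

section Entries

attribute [local instance] Matrix.frobeniusNormedAddCommGroup Matrix.frobeniusNormedSpace

theorem AnalyticAtZero.entry {n : ℕ} {H : ℝ → Herm n} (hH : AnalyticAtZero H) (i j : Fin n) :
    AnalyticAt ℝ (fun t => (H t : Matrix (Fin n) (Fin n) ℂ) i j) 0 :=
  ((Matrix.entryLinearMap ℝ ℂ i j).toContinuousLinearMap.analyticAt _).comp hH

end Entries

/-- The real polynomial whose roots are the eigenvalues of a Hermitian matrix. -/
noncomputable def eigPoly {n : ℕ} (A : Herm n) : ℝ[X] := ∏ i : Fin n, (X - C (eig A i))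

theorem eigPoly_map {n : ℕ} (A : Herm n) :
    (eigPoly A).map Complex.ofRealHom = (A : Matrix (Fin n) (Fin n) ℂ).charpoly := by
  rw [A.2.charpoly_eq, eigPoly, Polynomial.map_prod]
  refine Fintype.prod_equiv (Fin.revPerm.trans ((finCongr (Fintype.card_fin n).symm).trans
    (Fintype.equivOfCardEq (Fintype.card_fin _)))) _ _ fun i => ?_
  simp [eig, Matrix.IsHermitian.eigenvalues]

theorem eigPoly_monic {n : ℕ} (A : Herm n) : (eigPoly A).Monic :=
  monic_prod_of_monic _ _ fun _ _ => monic_X_sub_C _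

theorem natDegree_eigPoly {n : ℕ} (A : Herm n) : (eigPoly A).natDegree = n := by
  rw [eigPoly, natDegree_prod_of_monic _ _ fun _ _ => monic_X_sub_C _]
  simp

theorem eigPoly_splits {n : ℕ} (A : Herm n) : (eigPoly A).Splits :=
  Splits.prod fun _ _ => Splits.X_sub_C _

/-- The coefficients of the characteristic polynomial are universal polynomials in the matrix
entries, and here they are real. -/
theorem analyticAt_coeff_eigPoly {n : ℕ} {H : ℝ → Herm n} (hH : AnalyticAtZero H) (i : ℕ) :
    AnalyticAt ℝ (fun t => (eigPoly (H t)).coeff i) 0 := by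
  have hf : ∀ d : Fin n × Fin n,
      AnalyticAt ℝ (fun t => (H t : Matrix (Fin n) (Fin n) ℂ) d.1 d.2) 0 :=
    fun d => hH.entry d.1 d.2
  have h (P : MvPolynomial (Fin n × Fin n) ℝ) : AnalyticAt ℝ (fun t => MvPolynomial.aeval
      (fun d : Fin n × Fin n => (H t : Matrix (Fin n) (Fin n) ℂ) d.1 d.2) P) 0 :=
    AnalyticAt.aeval_mvPolynomial hf P
  refine ((Complex.reCLM.analyticAt _).comp
    (h ((Matrix.charpoly.univ ℝ (Fin n)).coeff i))).congr (Eventually.of_forall fun t => ?_)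
  have h2 := Matrix.charpoly.univ_coeff_eval₂Hom (Fin n) (algebraMap ℝ ℂ)
    (fun d : Fin n × Fin n => (H t : Matrix (Fin n) (Fin n) ℂ) d.1 d.2) i
  have h3 : (eigPoly (H t)).coeff i =
      (((eigPoly (H t)).map Complex.ofRealHom).coeff i).re := by simp
  rw [eigPoly_map] at h3
  refine Eq.trans ?_ h3.symm
  exact congrArg Complex.re h2

theorem eq_of_monotone_of_prod_eq {n : ℕ} {u v : Fin n → ℝ} (hu : Monotone u) (hv : Monotone v)
    (h : ∏ i, (X - C (u i)) = ∏ i, (X - C (v i))) : u = v := by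
  have hr : ∀ w : Fin n → ℝ, (∏ i, (X - C (w i))).roots = (List.ofFn w : Multiset ℝ) := by
    intro w
    rw [← Fin.univ_val_map, ← roots_multiset_prod_X_sub_C (Finset.univ.val.map w), Multiset.map_map]
    rfl
  have hm : (List.ofFn u : Multiset ℝ) = List.ofFn v := by rw [← hr, ← hr, h]
  exact List.ofFn_injective (List.Perm.eq_of_sortedLE hu.sortedLE_ofFn hv.sortedLE_ofFn
    (Multiset.coe_eq_coe.1 hm))

theorem exists_analytic_eigenvalues {n : ℕ} {H : ℝ → Herm n} (hH : AnalyticAtZero H) :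
    ∃ μ : Fin n → ℝ → ℝ, (∀ i, AnalyticAt ℝ (μ i) 0) ∧
      ∀ᶠ t in 𝓝 0, eigPoly (H t) = ∏ i, (X - C (μ i t)) := by
  obtain ⟨L, hL, hL'⟩ := exists_analytic_roots n (fun t => eigPoly (H t))
    (fun t => eigPoly_monic _) (fun t => natDegree_eigPoly _) (analyticAt_coeff_eigPoly hH)
    (Eventually.of_forall fun t => eigPoly_splits _)
  have hn : n = L.length := by
    have h := congrArg natDegree hL'.self_of_nhds
    rw [natDegree_eigPoly, ← Multiset.prod_coe, natDegree_multiset_prod_of_monic] at h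
    · simpa [Function.comp_def] using h
    · intro f hf
      obtain ⟨μ, -, rfl⟩ := List.mem_map.1 (Multiset.mem_coe.1 hf)
      exact monic_X_sub_C _
  refine ⟨fun i => L.get (Fin.cast hn i), fun i => hL _ (L.get_mem _), hL'.mono fun t ht => ?_⟩
  rw [ht, ← List.prod_ofFn]
  congr 1
  exact List.ext_getElem (by simp [hn]) fun i h1 h2 => by simp

/-- Finitely many functions that are pairwise eventually comparable can be sorted eventually. -/
theorem exists_perm_eventually_monotone {n : ℕ} {μ : Fin n → ℝ → ℝ} {l : Filter ℝ} [l.NeBot]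
    (h : ∀ i j, (∀ᶠ t in l, μ i t ≤ μ j t) ∨ ∀ᶠ t in l, μ j t < μ i t) :
    ∃ τ : Equiv.Perm (Fin n), ∀ᶠ t in l, Monotone fun i => μ (τ i) t := by
  have hev : ∀ᶠ t in l, ∀ i j, (∀ᶠ t in l, μ j t < μ i t) → μ j t < μ i t := by
    refine eventually_all.2 fun i => eventually_all.2 fun j => ?_
    by_cases hij : ∀ᶠ t in l, μ j t < μ i t
    · exact hij.mono fun t ht _ => ht
    · exact Eventually.of_forall fun t ht => absurd ht hij
  -- At the single point `s` all strict inequalities that hold eventually are valid together, so the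
  -- order found there is the eventual one.
  obtain ⟨s, hs⟩ := hev.exists
  refine ⟨Tuple.sort fun i => μ i s, ?_⟩
  refine eventually_all.2 fun i => eventually_all.2 fun j => ?_
  by_cases hij : i ≤ j
  · have hle : μ (Tuple.sort (fun i => μ i s) i) s ≤ μ (Tuple.sort (fun i => μ i s) j) s :=
      Tuple.monotone_sort (fun i => μ i s) hij
    rcases h (Tuple.sort (fun i => μ i s) i) (Tuple.sort (fun i => μ i s) j) with h1 | h1
    · exact h1.mono fun t ht _ => ht
    · exact absurd (hs _ _ h1) (not_lt.2 hle)
  · exact Eventually.of_forall fun t ht => absurd ht hij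

/-- Unless `f` vanishes near 0, it is a power of `t` times a function of constant sign near 0. -/
theorem eventually_nonneg_or_neg_right {f : ℝ → ℝ} (hf : AnalyticAt ℝ f 0) :
    (∀ᶠ t in 𝓝[>] 0, 0 ≤ f t) ∨ ∀ᶠ t in 𝓝[>] 0, f t < 0 := by
  rcases eq_or_ne (analyticOrderAt f 0) ⊤ with htop | hne
  · exact Or.inl (((analyticOrderAt_eq_top.1 htop).filter_mono nhdsWithin_le_nhds).mono
      fun t ht => ht.ge)
  obtain ⟨u, hu, hu0, hfu⟩ := hf.analyticOrderAt_ne_top.1 hne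
  simp only [sub_zero, smul_eq_mul] at hfu
  have hfu' := hfu.filter_mono (nhdsWithin_le_nhds (s := Set.Ioi 0))
  have hpos : ∀ᶠ t : ℝ in 𝓝[>] 0, 0 < t := eventually_mem_nhdsWithin
  rcases hu0.lt_or_gt with h | h
  · right
    filter_upwards [hfu', hpos, (hu.continuousAt.eventually_lt continuousAt_const
      h).filter_mono nhdsWithin_le_nhds] with t h1 h2 h3
    rw [h1]
    exact mul_neg_of_pos_of_neg (pow_pos h2 _) h3
  · left
    filter_upwards [hfu', hpos, (continuousAt_const.eventually_lt hu.continuousAt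
      h).filter_mono nhdsWithin_le_nhds] with t h1 h2 h3
    rw [h1]
    exact (mul_pos (pow_pos h2 _) h3).le

theorem exists_perm_monotone_right {n : ℕ} {μ : Fin n → ℝ → ℝ}
    (hμ : ∀ i, AnalyticAt ℝ (μ i) 0) :
    ∃ τ : Equiv.Perm (Fin n), ∀ᶠ t in 𝓝[>] 0, Monotone fun i => μ (τ i) t := by
  refine exists_perm_eventually_monotone fun i j => ?_
  rcases eventually_nonneg_or_neg_right ((hμ j).sub (hμ i)) with h | h
  · exact Or.inl (h.mono fun t ht => sub_nonneg.1 ht)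
  · exact Or.inr (h.mono fun t ht => sub_neg.1 ht)

theorem tendsto_neg_nhdsLT_zero : Tendsto (fun t : ℝ => -t) (𝓝[<] 0) (𝓝[>] 0) := by
  simpa using tendsto_neg_nhdsLT (a := (0 : ℝ))

theorem exists_perm_monotone_left {n : ℕ} {μ : Fin n → ℝ → ℝ}
    (hμ : ∀ i, AnalyticAt ℝ (μ i) 0) :
    ∃ τ : Equiv.Perm (Fin n), ∀ᶠ t in 𝓝[<] 0, Monotone fun i => μ (τ i) t := by
  obtain ⟨τ, hτ⟩ := exists_perm_monotone_right (μ := fun i t => μ i (-t)) fun i =>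
    AnalyticAt.fun_comp (g := μ i) (f := fun t : ℝ => -t) (by simpa using hμ i) analyticAt_id.fun_neg
  exact ⟨τ, by simpa using tendsto_neg_nhdsLT_zero.eventually hτ⟩

theorem eig_eq_of_monotone {n : ℕ} {A : Herm n} {v : Fin n → ℝ} (τ : Equiv.Perm (Fin n))
    (h : eigPoly A = ∏ i, (X - C (v i))) (hm : Monotone fun i => v (τ i)) (i : Fin n) :
    eig A i = v (τ i) := by
  refine congrFun (eq_of_monotone_of_prod_eq (eig_monotone A) hm ?_) i
  rw [Equiv.prod_comp τ fun i => X - C (v i), ← h, eigPoly]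

/-- Rellich's theorem for the eigenvalues of an analytic family of Hermitian matrices. -/
theorem exists_isAnalyticReordering {n : ℕ} {H : ℝ → Herm n} (hH : AnalyticAtZero H) :
    ∃ σ : Equiv.Perm (Fin n), IsAnalyticReordering H σ := by
  obtain ⟨μ, hμ, hp⟩ := exists_analytic_eigenvalues hH
  obtain ⟨τ, hτ⟩ := exists_perm_monotone_right hμ
  obtain ⟨ρ, hρ⟩ := exists_perm_monotone_left hμ
  -- `reorderedEig` puts `t = 0` on the right-hand side, so the sorting must be extended to 0 by
  -- continuity.
  have hτ0 : Monotone fun i => μ (τ i) 0 := fun i j hij =>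
    le_of_tendsto_of_tendsto ((hμ _).continuousAt.tendsto.mono_left nhdsWithin_le_nhds)
      ((hμ _).continuousAt.tendsto.mono_left nhdsWithin_le_nhds) (hτ.mono fun t ht => ht hij)
  -- The branch in position `i` on the right is `μ (τ i)`; on the left it occupies position `ρ.symm
  -- (τ i)`.
  refine ⟨τ.trans ρ.symm, fun i => (hμ (τ i)).congr ?_⟩
  filter_upwards [hp, eventually_nhdsWithin_iff.1 hτ, eventually_nhdsWithin_iff.1 hρ]
    with t h1 h2 h3
  rw [reorderedEig]
  split_ifs with ht
  · rcases ht.eq_or_lt with rfl | ht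
    · exact (eig_eq_of_monotone τ h1 hτ0 i).symm
    · exact (eig_eq_of_monotone τ h1 (h2 ht) i).symm
  · rw [eig_eq_of_monotone ρ h1 (h3 (not_le.1 ht))]
    simp

/-! ### Orders of splittings of sorted analytic functions. -/

theorem analyticOrderAt_le_of_abs_le {f g : ℝ → ℝ} (hf : AnalyticAt ℝ f 0)
    (hg : AnalyticAt ℝ g 0) (h : ∀ᶠ t in 𝓝[>] 0, |f t| ≤ |g t|) :
    analyticOrderAt g 0 ≤ analyticOrderAt f 0 := by
  refine ENat.forall_natCast_le_iff_le.1 fun n hn => le_analyticOrderAt_of_isBigO hf ?_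
  obtain ⟨w, hw, hgw⟩ := (natCast_le_analyticOrderAt hg).1 hn
  simp only [sub_zero, smul_eq_mul] at hgw
  have h1 : f =O[𝓝[>] 0] g := Asymptotics.IsBigO.of_bound 1 (by simpa using h)
  refine h1.trans (Asymptotics.IsBigO.mono ?_ nhdsWithin_le_nhds)
  refine (EventuallyEq.trans_isBigO hgw ?_)
  simpa using (Asymptotics.isBigO_refl (fun t : ℝ => t ^ n) (𝓝 0)).mul
    (hw.continuousAt.isBigO_one ℝ)

section Spread

variable {k : ℕ} {f : Fin k → ℝ → ℝ}

theorem abs_sub_le_of_monotone {v : Fin k → ℝ} (hv : Monotone v) {a b : Fin k}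
    (ha : ∀ i, a ≤ i) (hb : ∀ i, i ≤ b) (i j : Fin k) : |v i - v j| ≤ |v a - v b| := by
  have h1 := hv (ha i)
  have h2 := hv (ha j)
  have h3 := hv (hb i)
  have h4 := hv (hb j)
  rw [abs_sub_comm (v a), abs_of_nonneg (by linarith : 0 ≤ v b - v a), abs_le]
  constructor <;> linarith

theorem abs_sub_mean_le_of_monotone {v : Fin k → ℝ} (hv : Monotone v) {a b : Fin k}
    (ha : ∀ i, a ≤ i) (hb : ∀ i, i ≤ b) (i : Fin k) :
    |v i - (∑ j, v j) / k| ≤ |v a - v b| := by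
  have hk : (0 : ℝ) < k := by exact_mod_cast i.pos
  have h : v i - (∑ j, v j) / k = (∑ j, (v i - v j)) / k := by
    rw [Finset.sum_sub_distrib]
    simp
    field_simp
  rw [h, abs_div, abs_of_pos hk, div_le_iff₀ hk]
  calc |∑ j, (v i - v j)| ≤ ∑ j, |v i - v j| := Finset.abs_sum_le_sum_abs _ _
    _ ≤ ∑ _j : Fin k, |v a - v b| :=
      Finset.sum_le_sum fun j _ => abs_sub_le_of_monotone hv ha hb i j
    _ = |v a - v b| * k := by simp [mul_comm]

theorem order_pair_ge (hf : ∀ i, AnalyticAt ℝ (f i) 0)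
    (hm : ∀ᶠ t in 𝓝[>] 0, Monotone fun i => f i t) {a b : Fin k} (ha : ∀ i, a ≤ i)
    (hb : ∀ i, i ≤ b) (i j : Fin k) :
    analyticOrderAt (fun t => f a t - f b t) 0 ≤ analyticOrderAt (fun t => f i t - f j t) 0 :=
  analyticOrderAt_le_of_abs_le ((hf i).sub (hf j)) ((hf a).sub (hf b))
    (hm.mono fun _ ht => abs_sub_le_of_monotone ht ha hb i j)

theorem analyticAt_mean (hf : ∀ i, AnalyticAt ℝ (f i) 0) :
    AnalyticAt ℝ (fun t => (∑ i, f i t) / k) 0 :=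
  (Finset.analyticAt_fun_sum _ fun i _ => hf i).div_const

theorem iInf_order_pair (hf : ∀ i, AnalyticAt ℝ (f i) 0)
    (hm : ∀ᶠ t in 𝓝[>] 0, Monotone fun i => f i t) {a b : Fin k} (ha : ∀ i, a ≤ i)
    (hb : ∀ i, i ≤ b) :
    (⨅ (i : Fin k) (j : Fin k) (_ : i < j), analyticOrderAt (fun t => f i t - f j t) 0) =
      analyticOrderAt (fun t => f a t - f b t) 0 := by
  refine le_antisymm ?_ (le_iInf fun i => le_iInf fun j => le_iInf fun _ =>
    order_pair_ge hf hm ha hb i j)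
  -- The case `a = b` is `k = 1`: the infimum is empty and the splitting is identically zero, so
  -- both sides are `⊤`.
  rcases (ha b).eq_or_lt with rfl | h
  · have : analyticOrderAt (fun t => f a t - f a t) 0 = ⊤ :=
      analyticOrderAt_eq_top.2 (by simp)
    rw [this]
    exact le_top
  · exact iInf_le_of_le a (iInf_le_of_le b (iInf_le _ h))

theorem iInf_order_adjacent (hf : ∀ i, AnalyticAt ℝ (f i) 0)
    (hm : ∀ᶠ t in 𝓝[>] 0, Monotone fun i => f i t) {a b : Fin k} (ha : ∀ i, a ≤ i)
    (hb : ∀ i, i ≤ b) :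
    (⨅ (i : Fin k) (j : Fin k) (_ : (i : ℕ) + 1 = j),
      analyticOrderAt (fun t => f i t - f j t) 0) =
      analyticOrderAt (fun t => f a t - f b t) 0 := by
  refine le_antisymm ?_ (le_iInf fun i => le_iInf fun j => le_iInf fun _ =>
    order_pair_ge hf hm ha hb i j)
  set N := ⨅ (i : Fin k) (j : Fin k) (_ : (i : ℕ) + 1 = j),
      analyticOrderAt (fun t => f i t - f j t) 0 with hN
  have hN' : ∀ i j : Fin k, (i : ℕ) + 1 = j → N ≤ analyticOrderAt (fun t => f i t - f j t) 0 :=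
    fun i j hij => iInf_le_of_le i (iInf_le_of_le j (iInf_le _ hij))
  -- Telescoping: the order of a sum is at least the minimum of the orders.
  have key : ∀ (m : ℕ) (hmk : m < k), N ≤ analyticOrderAt (fun t => f a t - f ⟨m, hmk⟩ t) 0 := by
    intro m
    induction m with
    | zero =>
      intro hmk
      have h0 : a = ⟨0, hmk⟩ := le_antisymm (ha _) (Fin.mk_le_of_le_val (Nat.zero_le _))
      have : analyticOrderAt (fun t => f a t - f a t) 0 = ⊤ :=
        analyticOrderAt_eq_top.2 (by simp)
      rw [← h0, this]
      exact le_top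
    | succ m ih =>
      intro hmk
      have h1 := ih (by omega)
      have h2 := hN' ⟨m, by omega⟩ ⟨m + 1, hmk⟩ rfl
      refine (le_min h1 h2).trans (le_analyticOrderAt_add.trans_eq ?_)
      congr 1
      funext t
      simp
  exact key b b.2

theorem iInf_order_mean (hf : ∀ i, AnalyticAt ℝ (f i) 0)
    (hm : ∀ᶠ t in 𝓝[>] 0, Monotone fun i => f i t) {a b : Fin k} (ha : ∀ i, a ≤ i)
    (hb : ∀ i, i ≤ b) :
    (⨅ i : Fin k, analyticOrderAt (fun t => f i t - (∑ j, f j t) / k) 0) =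
      analyticOrderAt (fun t => f a t - f b t) 0 := by
  refine le_antisymm ?_ (le_iInf fun i => analyticOrderAt_le_of_abs_le
    ((hf i).sub (analyticAt_mean hf)) ((hf a).sub (hf b))
    (hm.mono fun _ ht => abs_sub_mean_le_of_monotone ht ha hb i))
  -- The mean cancels in the difference of the two extreme mean splittings.
  refine (le_min (iInf_le _ a) (iInf_le _ b)).trans (le_analyticOrderAt_sub.trans_eq ?_)
  congr 1
  funext t
  simp

theorem sign_mul_abs_self (t : ℝ) : Real.sign t * |t| = t := by
  rcases lt_trichotomy t 0 with h | rfl | h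
  · rw [Real.sign_of_neg h, abs_of_neg h]
    ring
  · simp
  · rw [Real.sign_of_pos h, abs_of_pos h, one_mul]

/-- The signed root mean square of finitely many analytic functions is analytic, of order the
minimum of their orders. -/
theorem analyticAt_signed_rms {g : Fin k → ℝ → ℝ} (hk : 0 < k) (hg : ∀ i, AnalyticAt ℝ (g i) 0)
    {r : ℕ∞} (hr : (⨅ i, analyticOrderAt (g i) 0) = r) :
    AnalyticAt ℝ (fun t => Real.sign t ^ r.toNat * Real.sqrt ((∑ i, g i t ^ 2) / k)) 0 ∧
      analyticOrderAt (fun t => Real.sign t ^ r.toNat * Real.sqrt ((∑ i, g i t ^ 2) / k)) 0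
        = r := by
  have hle : ∀ i, r ≤ analyticOrderAt (g i) 0 := fun i => hr ▸ iInf_le _ i
  have hk' : (0 : ℝ) < k := by exact_mod_cast hk
  induction r using ENat.recTopCoe with
  | top =>
    have hz : ∀ᶠ t in 𝓝 0, ∀ i, g i t = 0 :=
      eventually_all.2 fun i => analyticOrderAt_eq_top.1 (top_le_iff.1 (hle i))
    have hz' : ∀ᶠ t in 𝓝 0,
        Real.sign t ^ (⊤ : ℕ∞).toNat * Real.sqrt ((∑ i, g i t ^ 2) / k) = 0 := by
      filter_upwards [hz] with t ht
      simp [ht]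
    exact ⟨analyticAt_const.congr (hz'.mono fun t ht => ht.symm), analyticOrderAt_eq_top.2 hz'⟩
  | coe r =>
    choose w hw hgw using fun i => (natCast_le_analyticOrderAt (hg i)).1 (hle i)
    simp only [sub_zero, smul_eq_mul] at hgw
    have : Nonempty (Fin k) := ⟨⟨0, hk⟩⟩
    obtain ⟨i, hi⟩ := ciInf_mem fun i => analyticOrderAt (g i) 0
    replace hi : analyticOrderAt (g i) 0 = r := hi.trans hr
    -- For an index attaining the minimum, a zero of the cofactor would raise the order to at least
    -- `r + 1`. This makes the mean square of the cofactors positive at 0, where the square root is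
    -- analytic.
    have hi0 : w i 0 ≠ 0 := by
      intro h0
      have h1 : (1 : ℕ∞) ≤ analyticOrderAt (w i) 0 :=
        Order.one_le_iff_ne_zero.2 (((hw i).analyticOrderAt_ne_zero).2 h0)
      obtain ⟨z, hz, hwz⟩ := (natCast_le_analyticOrderAt (hw i) (n := 1)).1 (by exact_mod_cast h1)
      have h2 : ((r + 1 : ℕ) : ℕ∞) ≤ analyticOrderAt (g i) 0 := by
        refine (natCast_le_analyticOrderAt (hg i)).2 ⟨z, hz, ?_⟩
        filter_upwards [hgw i, hwz] with t h3 h4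
        rw [h3, h4]
        simp [pow_succ, mul_assoc]
      rw [hi, Nat.cast_le] at h2
      omega
    have hGa : AnalyticAt ℝ (fun t => (∑ i, w i t ^ 2) / k) 0 :=
      (Finset.analyticAt_fun_sum _ fun i _ => (hw i).pow 2).div_const
    have hG0 : 0 < (∑ i, w i 0 ^ 2) / (k : ℝ) := by
      refine div_pos (Finset.sum_pos' (fun j _ => sq_nonneg _) ⟨i, Finset.mem_univ i, ?_⟩) hk'
      positivity
    have hsq : AnalyticAt ℝ (fun t => Real.sqrt ((∑ i, w i t ^ 2) / k)) 0 :=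
      AnalyticAt.fun_comp (g := Real.sqrt) ((Real.contDiffAt_sqrt hG0.ne').analyticAt) hGa
    have heq : ∀ᶠ t in 𝓝 0,
        Real.sign t ^ (r : ℕ∞).toNat * Real.sqrt ((∑ i, g i t ^ 2) / k) =
          t ^ r * Real.sqrt ((∑ i, w i t ^ 2) / k) := by
      filter_upwards [eventually_all.2 hgw] with t ht
      have h1 : (∑ i, g i t ^ 2) / (k : ℝ) = (|t| ^ r) ^ 2 * ((∑ i, w i t ^ 2) / k) := by
        rw [← abs_pow, sq_abs, ← mul_div_assoc, Finset.mul_sum]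
        simp only [ht, mul_pow]
      rw [h1, Real.sqrt_mul (sq_nonneg _), Real.sqrt_sq (by positivity), ENat.toNat_natCast,
        ← mul_assoc, ← mul_pow, sign_mul_abs_self]
    have hana : AnalyticAt ℝ
        (fun t => Real.sign t ^ (r : ℕ∞).toNat * Real.sqrt ((∑ i, g i t ^ 2) / k)) 0 :=
      ((analyticAt_id.pow r).mul hsq).congr (heq.mono fun t ht => ht.symm)
    refine ⟨hana, hana.analyticOrderAt_eq_natCast.2 ⟨_, hsq, (Real.sqrt_pos.2 hG0).ne', ?_⟩⟩
    simpa using heq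

end Spread

/-! ### Analytic reorderings and the lowest `k` eigenvalues. -/

section Reordering

variable {n k : ℕ} {H : ℝ → Herm n} {σ : Equiv.Perm (Fin n)}

/-- Continuity of the branches identifies the left limits of the sorted eigenvalues with `eig (H 0)
∘ σ.symm`. This is therefore monotone, and a monotone rearrangement of a finite family is unique. -/
theorem IsAnalyticReordering.eig_zero_perm (hσ : IsAnalyticReordering H σ) (i : Fin n) :
    eig (H 0) (σ i) = eig (H 0) i := by
  have hlim : ∀ j, Tendsto (fun t => eig (H t) j) (𝓝[<] 0) (𝓝 (eig (H 0) (σ.symm j))) := by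
    intro j
    have h := ((hσ (σ.symm j)).continuousAt.tendsto).mono_left
      (nhdsWithin_le_nhds (s := Set.Iio 0))
    have h0 : reorderedEig H σ (σ.symm j) 0 = eig (H 0) (σ.symm j) := if_pos le_rfl
    rw [h0] at h
    refine h.congr' ?_
    filter_upwards [eventually_mem_nhdsWithin] with t (ht : t < 0)
    rw [reorderedEig, if_neg (not_le.2 ht), Equiv.apply_symm_apply]
  have hmono : Monotone (eig (H 0) ∘ σ.symm) := fun i j hij =>
    le_of_tendsto_of_tendsto' (hlim i) (hlim j) fun t => eig_monotone (H t) hij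
  have h := Tuple.unique_monotone (f := eig (H 0)) (σ := σ.symm) (τ := Equiv.refl _) hmono
    (by simpa using eig_monotone (H 0))
  simpa using (congrFun h (σ i)).symm

/-- The gap lets the low indices be recognized by their eigenvalue, which an analytic reordering
preserves at `t = 0`. -/
theorem lt_iff_eig_eq (hk : 1 ≤ k) (hkn : k ≤ n) {A : Herm n} (h0 : A ∈ GroundDegenerate n k)
    (i : Fin n) : (i : ℕ) < k ↔ eig A i = eig A ⟨0, by omega⟩ := by
  constructor
  · intro hi
    exact h0.1 i ⟨0, by omega⟩ hi hk
  · intro h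
    by_contra! hi
    have hlt := h0.2 ⟨k - 1, by omega⟩ ⟨k, by omega⟩ (by simp; omega) rfl
    have h1 : eig A ⟨k, by omega⟩ ≤ eig A i := eig_monotone A hi
    have h2 : eig A ⟨0, by omega⟩ ≤ eig A ⟨k - 1, by omega⟩ :=
      eig_monotone A (Fin.mk_le_mk.2 (Nat.zero_le _))
    linarith

/-- The reordering restricts to a permutation of the lowest `k` indices, so symmetric sums over them
do not see it. This holds for every `t`. -/
theorem IsAnalyticReordering.sum_low (hk : 1 ≤ k) (hkn : k ≤ n)
    (h0 : H 0 ∈ GroundDegenerate n k) (hσ : IsAnalyticReordering H σ) (F : ℝ → ℝ) (t : ℝ) :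
    ∑ i : Fin k, F (reorderedEig H σ (Fin.castLE hkn i) t) =
      ∑ i : Fin k, F (eig (H t) (Fin.castLE hkn i)) := by
  rcases le_or_gt 0 t with ht | ht
  · simp [reorderedEig, ht]
  have hlow : ∀ i : Fin k, (σ (Fin.castLE hkn i) : ℕ) < k := fun i => by
    rw [lt_iff_eig_eq hk hkn h0, hσ.eig_zero_perm, ← lt_iff_eig_eq hk hkn h0]
    simp
  let τ : Fin k → Fin k := fun i => ⟨σ (Fin.castLE hkn i), hlow i⟩
  have hτ : Function.Injective τ := fun i j hij => by
    have := σ.injective (Fin.ext (Fin.mk.inj_iff.1 hij))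
    exact Fin.castLE_injective hkn this
  rw [← (Finite.injective_iff_bijective.1 hτ).sum_comp
    fun i => F (eig (H t) (Fin.castLE hkn i))]
  refine Finset.sum_congr rfl fun i _ => ?_
  rw [reorderedEig, if_neg (not_le.2 ht)]
  rfl

theorem IsAnalyticReordering.lowMean_eq (hk : 1 ≤ k) (hkn : k ≤ n)
    (h0 : H 0 ∈ GroundDegenerate n k) (hσ : IsAnalyticReordering H σ) (t : ℝ) :
    lowMean hkn (H t) = (∑ i : Fin k, reorderedEig H σ (Fin.castLE hkn i) t) / k := by
  rw [lowMean, ← hσ.sum_low hk hkn h0 (fun x => x)]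

theorem IsAnalyticReordering.lowStdDev_eq (hk : 1 ≤ k) (hkn : k ≤ n)
    (h0 : H 0 ∈ GroundDegenerate n k) (hσ : IsAnalyticReordering H σ) (t : ℝ) :
    lowStdDev hkn (H t) =
      Real.sqrt ((∑ i : Fin k, meanSplitting hkn H σ i t ^ 2) / k) := by
  rw [lowStdDev, ← hσ.sum_low hk hkn h0 fun x => (x - lowMean hkn (H t)) ^ 2]
  rfl

/-- Both functions are the sorted eigenvalue for `t > 0`, and the identity theorem carries the
equality across 0. Hence orders do not depend on the chosen permutation. -/
theorem IsAnalyticReordering.eventuallyEq {ρ : Equiv.Perm (Fin n)}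
    (hσ : IsAnalyticReordering H σ) (hρ : IsAnalyticReordering H ρ) (i : Fin n) :
    reorderedEig H σ i =ᶠ[𝓝 0] reorderedEig H ρ i := by
  refine ((hσ i).frequently_eq_iff_eventually_eq (hρ i)).1 ?_
  have h : ∀ᶠ t in 𝓝[>] (0 : ℝ), reorderedEig H σ i t = reorderedEig H ρ i t := by
    filter_upwards [eventually_mem_nhdsWithin] with t (ht : 0 < t)
    simp [reorderedEig, ht.le]
  exact h.frequently.filter_mono (nhdsWithin_mono _ fun t ht => ne_of_gt ht)

theorem IsAnalyticReordering.monotone_right (hkn : k ≤ n) :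
    ∀ᶠ t in 𝓝[>] (0 : ℝ),
      Monotone fun i : Fin k => reorderedEig H σ (Fin.castLE hkn i) t := by
  filter_upwards [eventually_mem_nhdsWithin] with t (ht : 0 < t)
  intro i j hij
  simp only [reorderedEig, if_pos ht.le]
  exact eig_monotone _ hij

end Reordering

end EnergySplitting

theorem mainTheorem5 (n k : ℕ) (hk : 1 ≤ k) (hkn : k ≤ n)
    (H : ℝ → EnergySplitting.Herm n) (hH : EnergySplitting.AnalyticAtZero H)
    (h0 : H 0 ∈ EnergySplitting.GroundDegenerate n k) :
    (∃ σ : Equiv.Perm (Fin n), EnergySplitting.IsAnalyticReordering H σ) ∧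
    ∃ r : ℕ∞,
      AnalyticAt ℝ (EnergySplitting.signedStdDev hkn H r.toNat) 0 ∧
      analyticOrderAt (EnergySplitting.signedStdDev hkn H r.toNat) 0 = r ∧
      ∀ σ : Equiv.Perm (Fin n), EnergySplitting.IsAnalyticReordering H σ →
        (∀ i : Fin k, AnalyticAt ℝ (EnergySplitting.meanSplitting hkn H σ i) 0) ∧
        (⨅ (i : Fin k) (j : Fin k) (_ : i < j),
          analyticOrderAt (EnergySplitting.pairSplitting hkn H σ i j) 0) = r ∧
        (⨅ (i : Fin k) (j : Fin k) (_ : (i : ℕ) + 1 = j),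
          analyticOrderAt (EnergySplitting.pairSplitting hkn H σ i j) 0) = r ∧
        analyticOrderAt (EnergySplitting.pairSplitting hkn H σ
          ⟨0, Nat.lt_of_lt_of_le Nat.zero_lt_one hk⟩
          ⟨k - 1, Nat.sub_lt (Nat.lt_of_lt_of_le Nat.zero_lt_one hk) Nat.zero_lt_one⟩) 0 = r ∧
        (⨅ i : Fin k,
          analyticOrderAt (EnergySplitting.meanSplitting hkn H σ i) 0) = r := by
  obtain ⟨σ₀, hσ₀⟩ := EnergySplitting.exists_isAnalyticReordering hH
  refine ⟨⟨σ₀, hσ₀⟩, ?_⟩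
  set a : Fin k := ⟨0, Nat.lt_of_lt_of_le Nat.zero_lt_one hk⟩ with ha
  set b : Fin k :=
    ⟨k - 1, Nat.sub_lt (Nat.lt_of_lt_of_le Nat.zero_lt_one hk) Nat.zero_lt_one⟩ with hb
  have hai : ∀ i, a ≤ i := fun i => Fin.mk_le_of_le_val (Nat.zero_le _)
  have hib : ∀ i, i ≤ b := fun i => Fin.le_def.2 (Nat.le_sub_one_of_lt i.2)
  have hlow : ∀ σ, EnergySplitting.IsAnalyticReordering H σ → ∀ i : Fin k,
      AnalyticAt ℝ (EnergySplitting.reorderedEig H σ (Fin.castLE hkn i)) 0 :=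
    fun σ hσ i => hσ _
  have hmean : ∀ σ, EnergySplitting.IsAnalyticReordering H σ → ∀ i : Fin k,
      EnergySplitting.meanSplitting hkn H σ i = fun t =>
        EnergySplitting.reorderedEig H σ (Fin.castLE hkn i) t -
          (∑ j : Fin k, EnergySplitting.reorderedEig H σ (Fin.castLE hkn j) t) / k := by
    intro σ hσ i
    funext t
    rw [EnergySplitting.meanSplitting, hσ.lowMean_eq hk hkn h0]
  have hmeanA : ∀ σ, EnergySplitting.IsAnalyticReordering H σ → ∀ i : Fin k,
      AnalyticAt ℝ (EnergySplitting.meanSplitting hkn H σ i) 0 := by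
    intro σ hσ i
    rw [hmean σ hσ]
    exact (hσ _).sub (EnergySplitting.analyticAt_mean (hlow σ hσ))
  have hmeanO : ∀ σ, EnergySplitting.IsAnalyticReordering H σ →
      (⨅ i : Fin k, analyticOrderAt (EnergySplitting.meanSplitting hkn H σ i) 0) =
        analyticOrderAt (EnergySplitting.pairSplitting hkn H σ a b) 0 := by
    intro σ hσ
    simp only [hmean σ hσ]
    exact EnergySplitting.iInf_order_mean (hlow σ hσ)
      (EnergySplitting.IsAnalyticReordering.monotone_right hkn) hai hib
  have hindep : ∀ σ, EnergySplitting.IsAnalyticReordering H σ →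
      analyticOrderAt (EnergySplitting.pairSplitting hkn H σ a b) 0 =
        analyticOrderAt (EnergySplitting.pairSplitting hkn H σ₀ a b) 0 := fun σ hσ =>
    analyticOrderAt_congr ((hσ.eventuallyEq hσ₀ _).sub (hσ.eventuallyEq hσ₀ _))
  -- This fixes `r` as the order of the extreme splitting for `σ₀`. If it is `⊤`, then `r.toNat = 0`
  -- and the sign factor is 1.
  have hstd := EnergySplitting.analyticAt_signed_rms hk (hmeanA σ₀ hσ₀) (hmeanO σ₀ hσ₀)
  simp only [← hσ₀.lowStdDev_eq hk hkn h0] at hstd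
  refine ⟨_, hstd.1, hstd.2, fun σ hσ => ⟨hmeanA σ hσ, ?_, ?_, hindep σ hσ, ?_⟩⟩
  · rw [← hindep σ hσ]
    exact EnergySplitting.iInf_order_pair (hlow σ hσ)
      (EnergySplitting.IsAnalyticReordering.monotone_right hkn) hai hib
  · rw [← hindep σ hσ]
    exact EnergySplitting.iInf_order_adjacent (hlow σ hσ)
      (EnergySplitting.IsAnalyticReordering.monotone_right hkn) hai hib
  · rw [hmeanO σ hσ, hindep σ hσ]
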